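/- For a finite simple graph $G$ on $n$ vertices, let $S(G)$ be the set of all real symmetric $n\times n$ matrices $A=(a_{ij})$, with rows and columns indexed by the vertices of $G$, such that for all $i\neq j$, $a_{ij}\neq 0$ if and only if $i$ and $j$ are adjacent in $G$ (the diagonal entries are arbitrary). Let $q(A)$ denote the number of distinct eigenvalues of $A$, and let $q(G)=\min\{q(A): A\in S(G)\}$. Let $K_1$ be the graph with a single vertex, $C_n$ ($n\ge 3$) the cycle on $n$ vertices, and $G\vee H$ the join of $G$ and $H$, that is, the graph obtained from the disjoint union of $G$ and $H$ by adding all edges with one endpoint in $G$ and one endpoint in $H$. **Theorem.** For every integer $k\ge 2$, $q(K_1\vee C_{2k})=k$. -/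

import Mathlib

namespace CycleJoin

/-- The join `G ∨ H`: the disjoint union of `G` and `H` together with all edges having one
endpoint in `G` and one endpoint in `H`. -/
def join {V W : Type*} (G : SimpleGraph V) (H : SimpleGraph W) : SimpleGraph (V ⊕ W) :=
  (G ⊕g H) ⊔ completeBipartiteGraph V W

/-- `S(G)`: the real symmetric matrices indexed by the vertices of `G` whose off-diagonal
`(i, j)` entry is nonzero exactly when `i` and `j` are adjacent; the diagonal is arbitrary. -/
def graphMatrices {V : Type*} (G : SimpleGraph V) : Set (Matrix V V ℝ) :=
  {A | A.IsSymm ∧ ∀ i j, i ≠ j → (A i j ≠ 0 ↔ G.Adj i j)}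

/-- `q(A)`: the number of distinct eigenvalues of a matrix `A`. -/
noncomputable def numDistinctEigenvalues {V : Type*} [Fintype V] [DecidableEq V]
    (A : Matrix V V ℝ) : ℕ :=
  (spectrum ℝ A).ncard

/-- `q(G)`: the minimum of `q(A)` over all `A` in `S(G)`. -/
noncomputable def minDistinctEigenvalues {V : Type*} [Fintype V] [DecidableEq V]
    (G : SimpleGraph V) : ℕ :=
  sInf (numDistinctEigenvalues '' graphMatrices G)

/-- `S(G)` is never empty, so the infimum defining `q(G)` is an attained minimum. -/
theorem graphMatrices_nonempty {V : Type*} (G : SimpleGraph V) : (graphMatrices G).Nonempty := by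
  classical
  refine ⟨G.adjMatrix ℝ, G.isSymm_adjMatrix, fun i j _ => ?_⟩
  simp [SimpleGraph.adjMatrix_apply]

theorem spectrum_finite {V : Type*} [Fintype V] [DecidableEq V] (A : Matrix V V ℝ) :
    (spectrum ℝ A).Finite :=
  A.finite_real_spectrum

end CycleJoin

/-! Lower bound. Let `B` be the rim block of a wheel matrix `A`, with sorted eigenvalues λ₀ ≤ … ≤
λ₂ₖ₋₁. Only the two permutations running once around the cycle contribute to det(xI - B) linearly in
a given edge weight, so negating that weight adds a nonzero constant c to the characteristic
polynomial (`exists_charpoly_shift`). Thus f and f + c are both real-rooted. At a multiple root of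
f, the Laguerre inequality for f + c determines the sign of f'', hence the parity of j whenever λⱼ =
λⱼ₊₁ (`parity_of_double_root`). All gaps of the other parity are strict. By interlacing, `A` has an
eigenvalue in each [λᵢ, λᵢ₊₁] and one at most λ₀; the strict gaps separate k of these from one
another.

Upper bound. Take a wheel matrix invariant under the reflection that swaps two halves of the rim.
Its odd part is a tridiagonal k × k matrix T with diagonal 2, …, 2, 1 - 1/k. Its even part is the
bordered matrix with hub entry 1 - 1/k, border S e₀ and block S², where S² is the path Laplacian.
That Laplacian is a product of difference operators, and passing to partial sums carries the even
eigenvalue equation for μ ≠ 0 to the one for T, read backwards. The entry 1 - 1/k makes 0 an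
eigenvalue of T as well. So every eigenvalue is a root of one polynomial of degree at most k. The
cosine transform supplies an S whose first column has no zero entry, so the hub is joined to every
rim vertex. -/

namespace CycleJoin

/-! ### Laguerre inequality and parity of double roots -/

open Polynomial in
/-- The Laguerre inequality for real-rooted polynomials. -/
theorem laguerre_nonneg {ι : Type*} (s : Finset ι) (r : ι → ℝ) (x : ℝ) :
    let g : ℝ[X] := ∏ i ∈ s, (X - C (r i))
    0 ≤ g.derivative.eval x ^ 2 - g.eval x * g.derivative.derivative.eval x := by
  classical
  induction s using Finset.induction_on with
  | empty => simp
  | insert a s ha ih =>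
    simp only [Finset.prod_insert ha] at ih ⊢
    set h : ℝ[X] := ∏ i ∈ s, (X - C (r i))
    simp only [derivative_mul, derivative_add, derivative_sub, derivative_X, derivative_C,
      eval_add, eval_mul, eval_sub, eval_X, eval_C, sub_zero, one_mul]
    nlinarith [mul_nonneg (sq_nonneg (x - r a)) ih, sq_nonneg (h.eval x)]

-- Write L(g) = g'² - g g''. For g = (X - a) h one has L(g) = (x - a)² L(h) + h(x)², and h(x) ≠ 0
-- when g(x) ≠ 0.
open Polynomial in
theorem laguerre_pos {ι : Type*} (s : Finset ι) (hs : s.Nonempty) (r : ι → ℝ) (x : ℝ)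
    (hx : (∏ i ∈ s, (X - C (r i)) : ℝ[X]).eval x ≠ 0) :
    let g : ℝ[X] := ∏ i ∈ s, (X - C (r i))
    0 < g.derivative.eval x ^ 2 - g.eval x * g.derivative.derivative.eval x := by
  classical
  obtain ⟨a, ha⟩ := hs
  rw [← Finset.insert_erase ha] at hx ⊢
  have ih := laguerre_nonneg (s.erase a) r x
  simp only [Finset.prod_insert (Finset.notMem_erase a s)] at ih hx ⊢
  set h : ℝ[X] := ∏ i ∈ s.erase a, (X - C (r i))
  have hh : h.eval x ≠ 0 := by
    intro h0
    exact hx (by rw [eval_mul, h0, mul_zero])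
  simp only [derivative_mul, derivative_add, derivative_sub, derivative_X, derivative_C,
    eval_add, eval_mul, eval_sub, eval_X, eval_C, sub_zero, one_mul]
  have := sq_pos_of_ne_zero hh
  nlinarith [mul_nonneg (sq_nonneg (x - r a)) ih]

open Polynomial in
/-- If `f = (X - l)² h` and a nontrivial vertical shift `f + c` is real-rooted, then `h l` has
the sign of `-c`. -/
theorem mul_eval_neg_of_shift_splits {ι : Type*} (s : Finset ι) (hs : s.Nonempty) (r : ι → ℝ)
    (h : ℝ[X]) (l c : ℝ) (hc : c ≠ 0)
    (hf : (∏ i ∈ s, (X - C (r i)) : ℝ[X]) = (X - C l) ^ 2 * h + C c) :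
    c * h.eval l < 0 := by
  have key := laguerre_pos s hs r l (by rw [hf]; simpa using hc)
  simp only [hf] at key
  simp only [pow_two, derivative_mul, derivative_add, derivative_sub, derivative_X, derivative_C,
    eval_add, eval_mul, eval_sub, eval_X, eval_C, sub_zero, one_mul, mul_zero,
    zero_mul, eval_one, zero_add, sub_self, add_zero, mul_one] at key
  linarith

open Polynomial in
/-- Double roots of a real-rooted polynomial of even degree, one of whose nontrivial vertical
shifts is also real-rooted, all occur at indices of the same parity. -/
theorem parity_of_double_root {n : ℕ} (hn : Even n) (lam r : Fin n → ℝ) (hmono : Monotone lam)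
    (c : ℝ) (hc : c ≠ 0)
    (hf : (∏ i, (X - C (r i)) : ℝ[X]) = ∏ i, (X - C (lam i)) + C c)
    (j : ℕ) (hj : j + 1 < n) (heq : lam ⟨j, by omega⟩ = lam ⟨j + 1, hj⟩) :
    c * (-1) ^ j < 0 := by
  set a : Fin n := ⟨j, by omega⟩ with ha
  set b : Fin n := ⟨j + 1, hj⟩ with hb
  have hab : a ≠ b := by simp [ha, hb]
  set s : Finset (Fin n) := (Finset.univ.erase a).erase b with hs
  have hprod : (∏ i, (X - C (lam i)) : ℝ[X]) = (X - C (lam a)) ^ 2 * ∏ i ∈ s, (X - C (lam i)) := by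
    rw [← Finset.mul_prod_erase Finset.univ _ (Finset.mem_univ a),
      ← Finset.mul_prod_erase (Finset.univ.erase a) _
        (Finset.mem_erase.2 ⟨hab.symm, Finset.mem_univ b⟩), ← heq]
    ring
  rw [hprod] at hf
  have key := mul_eval_neg_of_shift_splits Finset.univ ⟨a, Finset.mem_univ a⟩ r _ _ c hc hf
  rw [eval_prod] at key
  simp only [eval_sub, eval_X, eval_C] at key
  -- Strictness of `key` excludes a third root equal to `lam a`, so the sign of the product is found
  -- by counting the larger roots.
  have hne : ∀ i ∈ s, lam a - lam i ≠ 0 := by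
    intro i hi h0
    rw [Finset.prod_eq_zero hi h0] at key
    simp at key
  have hsplit : ∀ i ∈ s, lam a - lam i = (if b < i then -1 else 1) * |lam a - lam i| := by
    intro i hi
    have hia : i ≠ a ∧ i ≠ b := by simpa [hs, and_comm] using hi
    split_ifs with h
    · have : lam a ≤ lam i := by rw [heq]; exact hmono h.le
      rw [abs_of_nonpos (by linarith)]; ring
    · have : i ≤ a := by
        have h1 := Fin.val_ne_of_ne hia.1
        have h2 := Fin.val_ne_of_ne hia.2
        simp only [Fin.lt_def, Fin.le_def, ha, hb] at *
        omega
      rw [abs_of_nonneg (by linarith [hmono this])]; ring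
  rw [Finset.prod_congr rfl hsplit, Finset.prod_mul_distrib, Finset.prod_ite, Finset.prod_const,
    Finset.prod_const_one, mul_one] at key
  have hcard : (s.filter (fun i => b < i)).card = n - (j + 2) := by
    have : s.filter (fun i => b < i) = Finset.Ioi b := by
      ext i
      simp only [hs, Finset.mem_filter, Finset.mem_erase, Finset.mem_univ, Finset.mem_Ioi,
        and_true, and_iff_right_iff_imp]
      intro h
      refine ⟨h.ne', ?_⟩
      rintro rfl
      simp [Fin.lt_def, ha, hb] at h
    rw [this, Fin.card_Ioi, hb]
    simp only
    omega
  have hpos : 0 < ∏ i ∈ s, |lam a - lam i| := Finset.prod_pos fun i hi => abs_pos.2 (hne i hi)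
  -- The even degree enters only here.
  have hpow : (-1 : ℝ) ^ (n - (j + 2)) = (-1) ^ j := by
    obtain ⟨m, rfl⟩ := hn
    rw [neg_one_pow_congr]
    rw [Nat.even_sub (by omega), Nat.even_add, Nat.even_add]
    simp
  rw [hcard, hpow, ← mul_assoc] at key
  exact neg_of_mul_neg_left key hpos.le

/-! ### Changing the sign of one cycle edge -/

/-- Adding opposite multiples of a symmetric pair of corner entries to a tridiagonal matrix. -/
theorem det_corner_sub {R : Type*} [CommRing R] {m : ℕ} (T : Matrix (Fin (m + 2)) (Fin (m + 2)) R)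
    (hT : T.IsSymm) (htri : ∀ i j : Fin (m + 2), i.val + 1 < j.val → T i j = 0) (a : R)
    (N : R → Matrix (Fin (m + 2)) (Fin (m + 2)) R)
    (hN : ∀ t, N t = (T.updateRow 0 (T 0 + t • Pi.single (Fin.last _) 1)).updateRow (Fin.last _)
      (T (Fin.last _) + t • Pi.single 0 1)) :
    (N a).det - (N (-a)).det
      = 4 * a * ((-1) ^ (m + 1) * ∏ i : Fin (m + 1), T i.castSucc i.succ) := by
  have h0l : (0 : Fin (m + 2)) ≠ Fin.last _ := by simp [Fin.ext_iff]
  have hlow : ∀ i j : Fin (m + 2), j.val + 1 < i.val → T i j = 0 := fun i j h => by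
    rw [← hT.apply]; exact htri j i h
  -- Expanding along the unit row leaves a triangular minor whose diagonal is the subdiagonal of
  -- `T`; `hY` is the mirror image.
  have hX : (T.updateRow 0 (Pi.single (Fin.last _) 1)).det
      = (-1) ^ (m + 1) * ∏ i : Fin (m + 1), T i.castSucc i.succ := by
    rw [← Matrix.adjugate_apply, Matrix.adjugate_fin_succ_eq_det_submatrix,
      Matrix.det_of_isUpperTriangular]
    · simp only [Matrix.submatrix_apply, Fin.succAbove_zero, Fin.succAbove_last, Fin.val_last,
        Fin.val_zero, zero_add]
      congr 1
      exact Finset.prod_congr rfl fun i _ => hT.apply _ _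
    · intro i j hij
      simp only [Matrix.submatrix_apply, Fin.succAbove_zero, Fin.succAbove_last, id] at *
      apply hlow
      simpa using hij
  have hY : (T.updateRow (Fin.last _) (Pi.single 0 1)).det
      = (-1) ^ (m + 1) * ∏ i : Fin (m + 1), T i.castSucc i.succ := by
    rw [← Matrix.adjugate_apply, Matrix.adjugate_fin_succ_eq_det_submatrix,
      Matrix.det_of_isLowerTriangular]
    · simp only [Matrix.submatrix_apply, Fin.succAbove_zero, Fin.succAbove_last, Fin.val_last,
        Fin.val_zero, add_zero]
    · intro i j hij
      simp only [Matrix.submatrix_apply, Fin.succAbove_zero, Fin.succAbove_last] at *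
      apply htri
      simpa using hij
  -- Multilinearity in the two changed rows: the `t * t` term takes the same value at `a` and `-a`,
  -- so only the linear terms survive in the difference.
  have hexp : ∀ t, (N t).det = T.det + t * (T.updateRow (Fin.last _) (Pi.single 0 1)).det
      + t * (T.updateRow 0 (Pi.single (Fin.last _) 1)).det
      + t * t * ((T.updateRow 0 (Pi.single (Fin.last _) 1)).updateRow (Fin.last _)
        (Pi.single 0 1)).det := by
    intro t
    rw [hN, Matrix.det_updateRow_add, Matrix.det_updateRow_smul,
      Matrix.updateRow_comm _ h0l, Matrix.updateRow_comm _ h0l, Matrix.updateRow_eq_self,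
      Matrix.det_updateRow_add, Matrix.det_updateRow_smul, Matrix.updateRow_eq_self,
      Matrix.det_updateRow_add, Matrix.det_updateRow_smul, Matrix.updateRow_comm _ h0l.symm _ _]
    have : (T.updateRow (Fin.last _) (Pi.single 0 1)).updateRow 0 (T 0)
        = T.updateRow (Fin.last _) (Pi.single 0 1) := by
      rw [Matrix.updateRow_comm _ h0l.symm, Matrix.updateRow_eq_self]
    rw [Matrix.updateRow_comm _ h0l, this, Matrix.updateRow_comm T h0l.symm (Pi.single 0 1)]
    ring
  rw [hexp, hexp, hX, hY]
  ring

theorem cycleGraph_adj_iff_val {n : ℕ} (hn : 3 ≤ n) (i j : Fin n) :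
    (SimpleGraph.cycleGraph n).Adj i j ↔
      i.val + 1 = j.val ∨ j.val + 1 = i.val ∨ (i.val = 0 ∧ j.val + 1 = n) ∨
        (j.val = 0 ∧ i.val + 1 = n) := by
  have hi := i.isLt
  have hj := j.isLt
  have key : ∀ a b : ℕ, a < n → b < n → ((n - b + a) % n = 1 ↔ b + 1 = a ∨ (a = 0 ∧ b + 1 = n)) := by
    intro a b ha hb
    rcases le_or_gt b a with h | h
    · have : n - b + a = (a - b) + n := by omega
      rw [this, Nat.add_mod_right, Nat.mod_eq_of_lt (by omega)]
      omega
    · rw [Nat.mod_eq_of_lt (by omega)]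
      omega
  rw [SimpleGraph.cycleGraph_adj', Fin.val_sub, Fin.val_sub, key _ _ hi hj, key _ _ hj hi]
  tauto

open Polynomial Matrix in
/-- Negating one edge weight of a weighted cycle shifts the characteristic polynomial by a nonzero
constant. -/
theorem exists_charpoly_shift {n : ℕ} (hn : 3 ≤ n) (B : Matrix (Fin n) (Fin n) ℝ)
    (hB : B ∈ graphMatrices (SimpleGraph.cycleGraph n)) :
    ∃ (B' : Matrix (Fin n) (Fin n) ℝ) (c : ℝ), B'.IsSymm ∧ c ≠ 0 ∧
      B'.charpoly = B.charpoly + C c := by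
  obtain ⟨m, rfl⟩ : ∃ m, n = m + 2 := ⟨n - 2, by omega⟩
  obtain ⟨hsymm, hpat⟩ := hB
  set l : Fin (m + 2) := Fin.last (m + 1) with hl
  have hlv : l.val = m + 1 := rfl
  have h0l : (0 : Fin (m + 2)) ≠ l := by simp [hl, Fin.ext_iff]
  have hcorner : B 0 l ≠ 0 := by
    rw [hpat _ _ h0l, cycleGraph_adj_iff_val hn]
    simp [hlv]
  -- `M t` is `B` with both corner entries replaced by `t`: `M 0` is tridiagonal, and `M (-(B 0 l))`
  -- is the sign-changed matrix.
  let M : ℝ → Matrix (Fin (m + 2)) (Fin (m + 2)) ℝ := fun t =>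
    of fun i j => if (i = 0 ∧ j = l) ∨ (i = l ∧ j = 0) then t else B i j
  have hMs : ∀ t, (M t).IsSymm := by
    intro t
    ext i j
    simp only [M, transpose_apply, of_apply]
    rw [hsymm.apply j i]
    congr 1
    exact propext (by tauto)
  have hMB : M (B 0 l) = B := by
    ext i j
    simp only [M, of_apply]
    split_ifs with h
    · rcases h with ⟨rfl, rfl⟩ | ⟨rfl, rfl⟩
      · rfl
      · exact hsymm.apply _ _
    · rfl
  have hTs : (M 0).charmatrix.IsSymm := by
    rw [IsSymm, charmatrix, transpose_sub, scalar_apply, diagonal_transpose]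
    congr 1
    ext i j : 2
    simp [(hMs 0).apply i j]
  have hM0 : ∀ i j : Fin (m + 2), i.val + 1 < j.val → M 0 i j = 0 := by
    intro i j hij
    simp only [M, of_apply]
    split_ifs with h
    · rfl
    · by_contra h0
      rw [← ne_eq, hpat _ _ (by rintro rfl; omega), cycleGraph_adj_iff_val hn] at h0
      have := i.isLt
      have := j.isLt
      apply h
      simp only [Fin.ext_iff, hlv, Fin.val_zero]
      omega
  have hdet := det_corner_sub (M 0).charmatrix hTs (fun i j hij => by
      rw [charmatrix_apply_ne _ _ _ (by rintro rfl; omega), hM0 i j hij, C_0, neg_zero])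
      (C (B 0 l)) (fun t => ((M 0).charmatrix.updateRow 0 ((M 0).charmatrix 0 + t • Pi.single l 1)
        ).updateRow l ((M 0).charmatrix l + t • Pi.single 0 1)) (fun t => rfl)
  have hrow : ∀ t : ℝ, ((M 0).charmatrix.updateRow 0 ((M 0).charmatrix 0 + C (-t) • Pi.single l 1)
        ).updateRow l ((M 0).charmatrix l + C (-t) • Pi.single 0 1) = (M t).charmatrix := by
    intro t
    ext i j : 2
    by_cases hi : i = l
    · subst hi
      rw [updateRow_self, Pi.add_apply, Pi.smul_apply]
      by_cases hj : j = 0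
      · subst hj
        rw [charmatrix_apply_ne _ _ _ h0l.symm, charmatrix_apply_ne _ _ _ h0l.symm]
        simp [M]
      · have : M t l j = M 0 l j := by simp [M, hj, h0l.symm]
        rw [charmatrix_apply, charmatrix_apply, this]
        simp [hj]
    · rw [updateRow_ne hi]
      by_cases hi0 : i = 0
      · subst hi0
        rw [updateRow_self, Pi.add_apply, Pi.smul_apply]
        by_cases hj : j = l
        · subst hj
          rw [charmatrix_apply_ne _ _ _ h0l, charmatrix_apply_ne _ _ _ h0l]
          simp [M]
        · have : M t 0 j = M 0 0 j := by simp [M, hj, h0l]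
          rw [charmatrix_apply, charmatrix_apply, this]
          simp [hj]
      · rw [updateRow_ne hi0, charmatrix_apply, charmatrix_apply]
        simp [M, hi, hi0]
  have h1 := hrow (-(B 0 l))
  have h2 := hrow (B 0 l)
  rw [neg_neg] at h1
  rw [C_neg] at h2
  simp only [h1, h2, hMB] at hdet
  refine ⟨M (-(B 0 l)), 4 * B 0 l * ((-1) ^ (m + 1) *
    ∏ i : Fin (m + 1), -(B i.castSucc i.succ)), hMs _, ?_, ?_⟩
  · refine mul_ne_zero (mul_ne_zero (by norm_num) hcorner) (mul_ne_zero (by simp) ?_)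
    refine Finset.prod_ne_zero_iff.2 fun i _ => neg_ne_zero.2 ?_
    rw [hpat _ _ (by simp [Fin.ext_iff]), cycleGraph_adj_iff_val hn]
    simp
  · have h3 : ∀ i : Fin (m + 1), (M 0).charmatrix i.castSucc i.succ
        = C (-(B i.castSucc i.succ)) := by
      intro i
      rw [charmatrix_apply_ne _ _ _ (by simp [Fin.ext_iff])]
      have : M 0 i.castSucc i.succ = B i.castSucc i.succ := by
        simp only [M, of_apply]
        rw [if_neg]
        simp only [Fin.ext_iff, hlv, Fin.val_zero, Fin.val_castSucc, Fin.val_succ]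
        omega
      rw [this, C_neg]
    simp only [h3] at hdet
    rw [charpoly, charpoly, ← sub_eq_iff_eq_add', hdet]
    have h4 : (C 4 : ℝ[X]) = 4 := map_ofNat C 4
    rw [C_mul, C_mul, C_mul, h4, map_prod]
    simp

/-! ### Interlacing by quadratic forms -/

section RayleighArgument

variable {m : Type*} [Fintype m] [DecidableEq m]

open Matrix in
theorem toEuclideanLin_eigenvectorBasis {A : Matrix m m ℝ} (hA : A.IsHermitian) (i : m) :
    A.toEuclideanLin (hA.eigenvectorBasis i) = hA.eigenvalues i • hA.eigenvectorBasis i := by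
  ext j
  have := congrFun (hA.mulVec_eigenvectorBasis i) j
  simpa [toLpLin_apply] using this

open Matrix in
theorem inner_eigenvectorBasis_toEuclideanLin {A : Matrix m m ℝ} (hA : A.IsHermitian) (i : m)
    (x : EuclideanSpace ℝ m) :
    inner ℝ (hA.eigenvectorBasis i) (A.toEuclideanLin x)
      = hA.eigenvalues i * inner ℝ (hA.eigenvectorBasis i) x := by
  have hsym := isSymmetric_toEuclideanLin_iff.2 hA
  rw [← hsym, toEuclideanLin_eigenvectorBasis, real_inner_smul_left]

-- In an eigenbasis the inner product is the sum of (μᵢ - l)(μᵢ - l')⟨vᵢ, x⟩². If no μᵢ lay in [l,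
-- l'], all the coefficients would be positive.
open Matrix in
theorem exists_mem_spectrum_between {A : Matrix m m ℝ} (hA : A.IsHermitian) {l l' : ℝ}
    (x : EuclideanSpace ℝ m) (hx : x ≠ 0)
    (h : inner ℝ (A.toEuclideanLin x - l • x) (A.toEuclideanLin x - l' • x) ≤ 0) (hl : l ≤ l') :
    ∃ μ ∈ spectrum ℝ A, l ≤ μ ∧ μ ≤ l' := by
  by_contra hcon
  push Not at hcon
  rw [← hA.eigenvectorBasis.sum_inner_mul_inner] at h
  have hterm : ∀ i, inner ℝ (A.toEuclideanLin x - l • x) (hA.eigenvectorBasis i)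
      * inner ℝ (hA.eigenvectorBasis i) (A.toEuclideanLin x - l' • x)
      = (hA.eigenvalues i - l) * (hA.eigenvalues i - l')
        * inner ℝ (hA.eigenvectorBasis i) x ^ 2 := by
    intro i
    rw [real_inner_comm, inner_sub_right, inner_sub_right,
      inner_eigenvectorBasis_toEuclideanLin, real_inner_smul_right, real_inner_smul_right]
    ring
  simp only [hterm] at h
  have hpos : ∀ i, 0 < (hA.eigenvalues i - l) * (hA.eigenvalues i - l') := by
    intro i
    rcases lt_or_ge (hA.eigenvalues i) l with h1 | h1
    · exact mul_pos_of_neg_of_neg (by linarith) (by linarith)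
    · have := hcon _ (hA.eigenvalues_mem_spectrum_real i) h1
      exact mul_pos (by linarith) (by linarith)
  have hz := (Finset.sum_eq_zero_iff_of_nonneg
    (fun i _ => mul_nonneg (hpos i).le (sq_nonneg _))).1
    (le_antisymm h (Finset.sum_nonneg fun i _ => mul_nonneg (hpos i).le (sq_nonneg _)))
  apply hx
  apply hA.eigenvectorBasis.repr.injective
  ext i
  have := hz i (Finset.mem_univ i)
  simpa [(hpos i).ne', hA.eigenvectorBasis.repr_apply_apply] using this

open Matrix in
theorem exists_mem_spectrum_le {A : Matrix m m ℝ} (hA : A.IsHermitian) {l : ℝ}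
    (x : EuclideanSpace ℝ m) (hx : x ≠ 0) (h : inner ℝ x (A.toEuclideanLin x - l • x) ≤ 0) :
    ∃ μ ∈ spectrum ℝ A, μ ≤ l := by
  by_contra hcon
  push Not at hcon
  rw [← hA.eigenvectorBasis.sum_inner_mul_inner] at h
  have hterm : ∀ i, inner ℝ x (hA.eigenvectorBasis i)
      * inner ℝ (hA.eigenvectorBasis i) (A.toEuclideanLin x - l • x)
      = (hA.eigenvalues i - l) * inner ℝ (hA.eigenvectorBasis i) x ^ 2 := by
    intro i
    rw [real_inner_comm, inner_sub_right,
      inner_eigenvectorBasis_toEuclideanLin, real_inner_smul_right]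
    ring
  simp only [hterm] at h
  have hpos : ∀ i, 0 < hA.eigenvalues i - l := fun i =>
    sub_pos.2 (hcon _ (hA.eigenvalues_mem_spectrum_real i))
  have hz := (Finset.sum_eq_zero_iff_of_nonneg
    (fun i _ => mul_nonneg (hpos i).le (sq_nonneg _))).1
    (le_antisymm h (Finset.sum_nonneg fun i _ => mul_nonneg (hpos i).le (sq_nonneg _)))
  apply hx
  apply hA.eigenvectorBasis.repr.injective
  ext i
  have := hz i (Finset.mem_univ i)
  simpa [(hpos i).ne', hA.eigenvectorBasis.repr_apply_apply] using this

end RayleighArgument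

section Bordered

variable {ι m : Type*} [Fintype m]

/-- Extension of a vector by zero to the left summand of the index type. -/
noncomputable def extendZero (ι : Type*) {m : Type*} [Fintype m] :
    EuclideanSpace ℝ m →ₗ[ℝ] EuclideanSpace ℝ (ι ⊕ m) where
  toFun x := WithLp.toLp 2 (Sum.elim 0 x)
  map_add' x y := by ext (i | i) <;> simp
  map_smul' c x := by ext (i | i) <;> simp

theorem inner_extendZero [Fintype ι] (x y : EuclideanSpace ℝ m) :
    inner ℝ (extendZero ι x) (extendZero ι y) = inner ℝ x y := by
  simp [extendZero, PiLp.inner_apply]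

theorem inner_extendZero_add [Fintype ι] (x y : EuclideanSpace ℝ m) (z : ι → ℝ) :
    inner ℝ (extendZero ι x) (extendZero ι y + WithLp.toLp 2 (Sum.elim z 0)) = inner ℝ x y := by
  simp [extendZero, PiLp.inner_apply]

theorem extendZero_injective : Function.Injective (extendZero ι (m := m)) := by
  intro x y h
  ext i
  simpa [extendZero] using congrArg (fun v : EuclideanSpace ℝ (ι ⊕ m) => v (Sum.inr i)) h

variable [Fintype ι] [DecidableEq ι] [DecidableEq m]

open Matrix in
theorem toEuclideanLin_extendZero (A : Matrix (ι ⊕ m) (ι ⊕ m) ℝ) (x : EuclideanSpace ℝ m) :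
    A.toEuclideanLin (extendZero ι x) = extendZero ι (A.toBlocks₂₂.toEuclideanLin x)
      + WithLp.toLp 2 (Sum.elim (A.toBlocks₁₂ *ᵥ x) 0) := by
  ext (i | i) <;>
    simp [extendZero, toLpLin_apply, mulVec, dotProduct, toBlocks₁₂, toBlocks₂₂]

open Matrix in
/-- A bordered symmetric matrix has an eigenvalue between any two eigenvalues (with multiplicity)
of the matrix being bordered. -/
theorem exists_mem_spectrum_between_of_bordered [Unique ι] {A : Matrix (ι ⊕ m) (ι ⊕ m) ℝ}
    (hA : A.IsHermitian) (hB : A.toBlocks₂₂.IsHermitian) {i j : m} (hij : i ≠ j)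
    (hle : hB.eigenvalues i ≤ hB.eigenvalues j) :
    ∃ μ ∈ spectrum ℝ A, hB.eigenvalues i ≤ μ ∧ μ ≤ hB.eigenvalues j := by
  set v := hB.eigenvectorBasis with hv
  set p : m → ℝ := fun a => (A.toBlocks₁₂ *ᵥ v a) default with hp
  -- The border is a single row, so some nonzero combination of the two eigenvectors is annihilated
  -- by it; on its zero extension `A` acts as the inner block.
  obtain ⟨a, b, hab, hne⟩ : ∃ a b : ℝ, a * p i + b * p j = 0 ∧ (a ≠ 0 ∨ b ≠ 0) := by
    by_cases h : p i = 0
    · exact ⟨1, 0, by simp [h], by simp⟩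
    · exact ⟨p j, -p i, by ring, Or.inr (neg_ne_zero.2 h)⟩
  set x : EuclideanSpace ℝ m := a • v i + b • v j with hx
  have hAx : A.toEuclideanLin (extendZero ι x)
      = extendZero ι (A.toBlocks₂₂.toEuclideanLin x) := by
    rw [toEuclideanLin_extendZero]
    have : A.toBlocks₁₂ *ᵥ x = 0 := by
      ext t
      rw [Subsingleton.elim t default]
      rw [hx]
      simpa [mulVec_add, mulVec_smul, hp] using hab
    rw [this]
    ext (t | t) <;> simp
  have hBx : A.toBlocks₂₂.toEuclideanLin x
      = (a * hB.eigenvalues i) • v i + (b * hB.eigenvalues j) • v j := by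
    rw [hx, map_add, map_smul, map_smul, hv, toEuclideanLin_eigenvectorBasis,
      toEuclideanLin_eigenvectorBasis, smul_smul, smul_smul]
  refine exists_mem_spectrum_between hA (extendZero ι x) ?_ ?_ hle
  · rw [← map_zero (extendZero ι (m := m))]
    refine extendZero_injective.ne ?_
    intro h0
    have hi : inner ℝ (v i) x = a := by
      simp [hx, inner_add_right, inner_smul_right, v.inner_eq_ite, hij]
    have hj : inner ℝ (v j) x = b := by
      simp [hx, inner_add_right, inner_smul_right, v.inner_eq_ite, hij.symm]
    rw [h0, inner_zero_right] at hi hj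
    rcases hne with h | h
    · exact h hi.symm
    · exact h hj.symm
  · rw [hAx, ← map_smul, ← map_smul, ← map_sub, ← map_sub, inner_extendZero, hBx]
    have h1 : (a * hB.eigenvalues i) • v i + (b * hB.eigenvalues j) • v j
        - hB.eigenvalues i • x = (b * (hB.eigenvalues j - hB.eigenvalues i)) • v j := by
      rw [hx]; module
    have h2 : (a * hB.eigenvalues i) • v i + (b * hB.eigenvalues j) • v j
        - hB.eigenvalues j • x = (a * (hB.eigenvalues i - hB.eigenvalues j)) • v i := by
      rw [hx]; module
    rw [h1, h2, inner_smul_left, inner_smul_right, v.inner_eq_ite, if_neg hij.symm]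
    simp

-- A zero-extended eigenvector of the block keeps its Rayleigh quotient, because the border
-- contributes only in coordinates where the vector vanishes.
open Matrix in
theorem exists_mem_spectrum_le_of_bordered {A : Matrix (ι ⊕ m) (ι ⊕ m) ℝ}
    (hA : A.IsHermitian) (hB : A.toBlocks₂₂.IsHermitian) (i : m) :
    ∃ μ ∈ spectrum ℝ A, μ ≤ hB.eigenvalues i := by
  refine exists_mem_spectrum_le hA (extendZero ι (hB.eigenvectorBasis i)) ?_ ?_
  · rw [← map_zero (extendZero ι (m := m))]
    exact extendZero_injective.ne (hB.eigenvectorBasis.toBasis.ne_zero i)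
  · rw [inner_sub_right, toEuclideanLin_extendZero, inner_extendZero_add, inner_smul_right,
      inner_extendZero, toEuclideanLin_eigenvectorBasis, inner_smul_right, sub_self]

end Bordered

/-! ### The lower bound -/

theorem rim_mem_graphMatrices {V W : Type*} (G : SimpleGraph V) (H : SimpleGraph W)
    {A : Matrix (V ⊕ W) (V ⊕ W) ℝ} (hA : A ∈ graphMatrices (join G H)) :
    A.toBlocks₂₂ ∈ graphMatrices H := by
  refine ⟨?_, fun i j hij => ?_⟩
  · ext i j
    exact hA.1.apply _ _
  · have := hA.2 (Sum.inr i) (Sum.inr j) (by simpa using hij)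
    simpa [join, Matrix.toBlocks₂₂] using this

/-- Every matrix of the wheel with `2k` rim vertices has at least `k` distinct eigenvalues. -/
theorem le_numDistinctEigenvalues_wheel (k : ℕ) (hk : 2 ≤ k)
    (A : Matrix (Fin 1 ⊕ Fin (2 * k)) (Fin 1 ⊕ Fin (2 * k)) ℝ)
    (hA : A ∈ graphMatrices (join (⊤ : SimpleGraph (Fin 1)) (SimpleGraph.cycleGraph (2 * k)))) :
    k ≤ numDistinctEigenvalues A := by
  have hrim := rim_mem_graphMatrices _ _ hA
  have hAh : A.IsHermitian := by
    rw [Matrix.IsHermitian, Matrix.conjTranspose_eq_transpose_of_trivial]; exact hA.1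
  have hBh : A.toBlocks₂₂.IsHermitian := by
    rw [Matrix.IsHermitian, Matrix.conjTranspose_eq_transpose_of_trivial]; exact hrim.1
  obtain ⟨B', c, hB's, hc, hB'⟩ := exists_charpoly_shift (by omega) _ hrim
  have hB'h : B'.IsHermitian := by
    rw [Matrix.IsHermitian, Matrix.conjTranspose_eq_transpose_of_trivial]; exact hB's
  set e := Tuple.sort hBh.eigenvalues
  have hmono : Monotone (hBh.eigenvalues ∘ e) := Tuple.monotone_sort _
  have hpoly : (∏ i, (Polynomial.X - Polynomial.C (hB'h.eigenvalues i)) : Polynomial ℝ)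
      = ∏ i, (Polynomial.X - Polynomial.C ((hBh.eigenvalues ∘ e) i)) + Polynomial.C c := by
    rw [hB'h.charpoly_eq, hBh.charpoly_eq] at hB'
    rw [show (∏ i, (Polynomial.X - Polynomial.C ((hBh.eigenvalues ∘ e) i)) : Polynomial ℝ)
      = ∏ i, (Polynomial.X - Polynomial.C (hBh.eigenvalues i)) from
        Equiv.prod_comp e (fun i => Polynomial.X - Polynomial.C (hBh.eigenvalues i))]
    exact hB'
  have hpar := parity_of_double_root (even_two_mul k) (hBh.eigenvalues ∘ e) hB'h.eigenvalues
    hmono c hc hpoly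
  have hpair : ∀ i (h : i + 1 < 2 * k), ∃ μ ∈ spectrum ℝ A,
      (hBh.eigenvalues ∘ e) ⟨i, by omega⟩ ≤ μ ∧ μ ≤ (hBh.eigenvalues ∘ e) ⟨i + 1, h⟩ := by
    intro i h
    refine exists_mem_spectrum_between_of_bordered hAh hBh (e.injective.ne ?_) (hmono ?_)
    · simp
    · simp [Fin.le_def]
  have hmin : ∃ μ ∈ spectrum ℝ A, μ ≤ (hBh.eigenvalues ∘ e) ⟨0, by omega⟩ :=
    exists_mem_spectrum_le_of_bordered hAh hBh _
  generalize hBh.eigenvalues ∘ e = lam at *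
  suffices h : ∃ ν : Fin k → ℝ, (∀ i, ν i ∈ spectrum ℝ A) ∧ StrictMono ν by
    obtain ⟨ν, hν, hmν⟩ := h
    have h1 : (Set.range ν).ncard ≤ (spectrum ℝ A).ncard :=
      Set.ncard_le_ncard (Set.range_subset_iff.2 hν) (spectrum_finite A)
    rw [← Set.image_univ, Set.ncard_image_of_injective _ hmν.injective, Set.ncard_univ] at h1
    simpa [numDistinctEigenvalues] using h1
  have hstrict : ∀ i (h : i + 1 < 2 * k), 0 < c * (-1) ^ i →
      lam ⟨i, by omega⟩ < lam ⟨i + 1, h⟩ := by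
    intro i h hpos
    refine lt_of_le_of_ne (hmono (by simp [Fin.le_def])) fun heq => ?_
    exact absurd (hpar i h heq) (not_lt.2 hpos.le)
  rcases lt_or_gt_of_ne hc with hneg | hpos
  -- For c < 0 equalities occur only at even indices, so the k intervals [λ₂ᵢ, λ₂ᵢ₊₁] are pairwise
  -- disjoint.
  · choose ν hν h1 h2 using fun i : Fin k => hpair (2 * i.val) (by omega)
    refine ⟨ν, hν, fun i j hij => ?_⟩
    have hij' : i.val < j.val := hij
    have hs := hstrict (2 * i.val + 1) (by omega) (by
      rw [pow_succ, pow_mul]; simpa using hneg)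
    calc ν i ≤ _ := h2 i
      _ < _ := hs
      _ ≤ _ := hmono (by simp only [Fin.le_def]; omega)
      _ ≤ ν j := h1 j
  -- For c > 0 equalities occur only at odd indices: the k - 1 intervals [λ₂ᵢ₋₁, λ₂ᵢ] with i ≥ 1 are
  -- used, together with the eigenvalue at most λ₀.
  · have hex : ∀ i : Fin k, ∃ μ ∈ spectrum ℝ A, μ ≤ lam ⟨2 * i.val, by omega⟩ ∧
        (∀ h : 0 < i.val, lam ⟨2 * i.val - 1, by omega⟩ ≤ μ) := by
      intro i
      rcases Nat.eq_zero_or_pos i.val with h0 | h0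
      · obtain ⟨μ, hμ, hle⟩ := hmin
        exact ⟨μ, hμ, by simpa [h0] using hle, fun h => absurd h (by omega)⟩
      · obtain ⟨μ, hμ, hle, hge⟩ := hpair (2 * i.val - 1) (by omega)
        refine ⟨μ, hμ, ?_, fun _ => hle⟩
        convert hge using 3
        omega
    choose ν hν h1 h2 using hex
    refine ⟨ν, hν, fun i j hij => ?_⟩
    have hij' : i.val < j.val := hij
    have hs := hstrict (2 * i.val) (by omega) (by
      rw [pow_mul]; simpa using hpos)
    calc ν i ≤ _ := h1 i
      _ < _ := hs
      _ ≤ _ := hmono (by simp only [Fin.le_def]; omega)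
      _ ≤ ν j := h2 j (by omega)

/-- The Laplacian matrix of the path on `k` vertices. -/
def pathLaplacian (k : ℕ) : Matrix (Fin k) (Fin k) ℝ :=
  Matrix.of fun i j => if i = j then (if i.val = 0 ∨ i.val + 1 = k then 1 else 2)
    else if i.val + 1 = j.val ∨ j.val + 1 = i.val then -1 else 0

-- Repeating the end values (a Neumann condition) turns the exceptional end rows into the interior
-- second difference.
open Matrix in
theorem pathLaplacian_mulVec {k : ℕ} (hk : 2 ≤ k) (v : Fin k → ℝ) (G : ℕ → ℝ)
    (hv : ∀ i : Fin k, v i = G (i + 1)) (h0 : G 0 = G 1) (h1 : G (k + 1) = G k) (i : Fin k) :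
    (pathLaplacian k *ᵥ v) i = 2 * G (i + 1) - G i - G (i + 2) := by
  have hi := i.isLt
  set d : ℝ := if i.val = 0 ∨ i.val + 1 = k then 1 else 2 with hd
  -- At `i = 0` the truncated `i - 1` is again 0; the inner `if` removes that spurious term.
  have hsum : (pathLaplacian k *ᵥ v) i = ∑ j ∈ Finset.range k,
      ((if j = i.val then d * G (i + 1) else 0) + (if j = i.val + 1 then -G (i + 2) else 0)
        + (if j = i.val - 1 then (if i.val = 0 then 0 else -G i) else 0)) := by
    rw [← Fin.sum_univ_eq_sum_range (fun j => (if j = i.val then d * G (i + 1) else 0)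
      + (if j = i.val + 1 then -G (i + 2) else 0)
      + (if j = i.val - 1 then (if i.val = 0 then 0 else -G i) else 0)), mulVec, dotProduct]
    refine Finset.sum_congr rfl fun j _ => ?_
    simp only [pathLaplacian, of_apply, hv, Fin.ext_iff, ← hd]
    by_cases e1 : i.val = j.val
    · rw [if_pos e1, if_pos e1.symm, if_neg (by omega), ← e1]
      by_cases hz : i.val = 0
      · simp [hz]
      · rw [if_neg (by omega : ¬ i.val = i.val - 1)]; ring
    · rw [if_neg e1, if_neg (fun h : j.val = i.val => e1 h.symm)]
      by_cases e2 : i.val + 1 = j.val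
      · rw [if_pos (Or.inl e2), if_pos e2.symm, if_neg (by omega), ← e2]; ring
      · rw [if_neg (fun h : j.val = i.val + 1 => e2 h.symm)]
        by_cases e3 : j.val + 1 = i.val
        · rw [if_pos (Or.inr e3), if_pos (by omega), if_neg (by omega), e3]; ring
        · rw [if_neg (by omega)]
          by_cases hz : i.val = 0
          · simp [hz]
          · rw [if_neg (by omega)]; ring
  rw [hsum, Finset.sum_add_distrib, Finset.sum_add_distrib, Finset.sum_ite_eq', Finset.sum_ite_eq',
    Finset.sum_ite_eq']
  simp only [Finset.mem_range, hd]
  rw [if_pos hi, if_pos (by omega : i.val - 1 < k)]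
  by_cases hz : i.val = 0
  · rw [if_pos (Or.inl hz), if_pos hz, if_pos (by omega), hz, h0]; ring
  · rw [if_neg hz]
    by_cases hl : i.val + 1 = k
    · rw [if_pos (Or.inr hl), if_neg (by omega), show i.val + 2 = k + 1 by omega, h1, hl]; ring
    · rw [if_neg (by omega), if_pos (by omega)]; ring

theorem pathLaplacian_isSymm (k : ℕ) : (pathLaplacian k).IsSymm := by
  ext i j
  simp only [pathLaplacian, Matrix.transpose_apply, Matrix.of_apply]
  by_cases h : i = j
  · simp [h]
  · rw [if_neg h, if_neg (Ne.symm h)]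
    simp only [or_comm]

-- Multiplying by 2 sin(πm/2k), nonzero since 0 < |m| < 2k, telescopes the sum to sin(πm) = 0.
open Real in
theorem sum_cos_odd_multiples {k : ℕ} (hk : 0 < k) (m : ℤ) (hm : m ≠ 0) (hm1 : -(2 * k : ℤ) < m)
    (hm2 : m < 2 * k) : ∑ i ∈ Finset.range k, cos (π * m * (2 * i + 1) / (2 * k)) = 0 := by
  have hk' : (0 : ℝ) < k := by exact_mod_cast hk
  have hs : sin (π * m / (2 * k)) ≠ 0 := by
    rw [Ne, sin_eq_zero_iff]
    rintro ⟨n, hn⟩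
    have h2 : (n : ℝ) * (2 * k) = m := by
      field_simp at hn
      nlinarith [pi_pos]
    have h3 : n * (2 * k) = m := by exact_mod_cast h2
    have hk'' : (0 : ℤ) < k := by exact_mod_cast hk
    have hn0 : n ≠ 0 := by rintro rfl; simp at h3; exact hm h3.symm
    rcases lt_or_gt_of_ne hn0 with h | h
    · nlinarith
    · nlinarith
  have htel : ∀ n : ℕ, 2 * sin (π * m / (2 * k)) *
      ∑ i ∈ Finset.range n, cos (π * m * (2 * i + 1) / (2 * k)) = sin (π * m * n / k) := by
    intro n
    induction n with
    | zero => simp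
    | succ n ih =>
      rw [Finset.sum_range_succ, mul_add, ih]
      have e1 : π * m * n / k = π * m * (2 * n + 1) / (2 * k) - π * m / (2 * k) := by
        field_simp; ring
      have e2 : π * m * ((n + 1 : ℕ) : ℝ) / k
          = π * m * (2 * n + 1) / (2 * k) + π * m / (2 * k) := by
        push_cast; field_simp; ring
      rw [e1, e2, sin_sub, sin_add]
      ring
  have h := htel k
  rw [show π * m * k / k = m * π by field_simp, sin_int_mul_pi] at h
  exact (mul_eq_zero.1 h).resolve_left (mul_ne_zero two_ne_zero hs)

open Real in
theorem two_mul_sum_sin {k : ℕ} (hk : 0 < k) (M : ℤ) (hM : Odd M) :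
    2 * sin (M * π / (4 * k)) * ∑ j ∈ Finset.range k, sin (M * π / (2 * k) * j)
      = cos (M * π / (4 * k)) - sin (M * π / 2) * sin (M * π / (4 * k)) := by
  have hk' : (0 : ℝ) < k := by exact_mod_cast hk
  have htel : ∀ n : ℕ, 2 * sin (M * π / (4 * k)) *
      ∑ j ∈ Finset.range n, sin (M * π / (2 * k) * j)
      = cos (M * π / (4 * k)) - cos (M * π / (2 * k) * n - M * π / (4 * k)) := by
    intro n
    induction n with
    | zero => simp
    | succ n ih =>
      rw [Finset.sum_range_succ, mul_add, ih]
      have e2 : M * π / (2 * k) * ((n + 1 : ℕ) : ℝ) - M * π / (4 * k)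
          = M * π / (2 * k) * n + M * π / (4 * k) := by
        push_cast; field_simp; ring
      rw [e2, cos_sub, cos_add]
      ring
  rw [htel, show M * π / (2 * k) * k = M * π / 2 by field_simp, cos_sub]
  obtain ⟨r, rfl⟩ := hM
  have : cos (((2 * r + 1 : ℤ) : ℝ) * π / 2) = 0 := by
    rw [cos_eq_zero_iff]
    exact ⟨r, by push_cast; ring⟩
  rw [this]
  ring

-- The sum is half the difference of two sine sums, with M = 2i + 3 and M = 2i - 1. Each equals
-- (cot(Mπ/4k) - sin(Mπ/2))/2, and the second terms agree. A zero would force equal cotangents,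
-- hence sin(π/k) = 0.
open Real in
theorem sum_sin_mul_cos_ne_zero {k : ℕ} (hk : 2 ≤ k) (i : ℕ) :
    ∑ j ∈ Finset.range k, sin (π * j / k) * cos (π * j * (2 * i + 1) / (2 * k)) ≠ 0 := by
  have hk' : (0 : ℝ) < k := by positivity
  have h1 := two_mul_sum_sin (k := k) (by omega) (2 * i + 3) ⟨i + 1, by ring⟩
  have h2 := two_mul_sum_sin (k := k) (by omega) (2 * i - 1) ⟨i - 1, by ring⟩
  set a : ℝ := ((2 * i + 3 : ℤ) : ℝ) with ha
  set b : ℝ := ((2 * i - 1 : ℤ) : ℝ) with hb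
  have hab : a = b + 4 := by rw [ha, hb]; push_cast; ring
  have hsin : sin (a * π / 2) = sin (b * π / 2) := by
    rw [hab, show (b + 4) * π / 2 = b * π / 2 + 2 * π by ring, sin_add_two_pi]
  rw [hsin] at h1
  have hdiff : ∑ j ∈ Finset.range k, sin (a * π / (2 * k) * j)
      - ∑ j ∈ Finset.range k, sin (b * π / (2 * k) * j)
      = 2 * ∑ j ∈ Finset.range k, sin (π * j / k) * cos (π * j * (2 * i + 1) / (2 * k)) := by
    rw [← Finset.sum_sub_distrib, Finset.mul_sum]
    refine Finset.sum_congr rfl fun j _ => ?_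
    have e1 : a * π / (2 * k) * j = π * j * (2 * i + 1) / (2 * k) + π * j / k := by
      rw [ha]; push_cast; field_simp; ring
    have e2 : b * π / (2 * k) * j = π * j * (2 * i + 1) / (2 * k) - π * j / k := by
      rw [hb]; push_cast; field_simp; ring
    rw [e1, e2, sin_add, sin_sub]
    ring
  intro h0
  rw [h0, mul_zero, sub_eq_zero] at hdiff
  rw [hdiff] at h1
  have hfin : sin (π / k) = 0 := by
    have e : π / k = a * π / (4 * k) - b * π / (4 * k) := by
      rw [hab]; field_simp; ring
    rw [e, sin_sub]
    linear_combination sin (b * π / (4 * k)) * h1 - sin (a * π / (4 * k)) * h2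
  have hk2 : (2 : ℝ) ≤ k := by exact_mod_cast hk
  refine (sin_pos_of_pos_of_lt_pi (by positivity) ?_).ne' hfin
  rw [div_lt_iff₀ hk']
  nlinarith [pi_pos]

open Real in
/-- The orthonormal discrete cosine transform. -/
noncomputable def cosineTransform (k : ℕ) : Matrix (Fin k) (Fin k) ℝ :=
  Matrix.of fun j i => √((if j.val = 0 then 1 else 2) / k) * cos (π * j * (2 * i + 1) / (2 * k))

open Real Matrix in
theorem cosineTransform_mul_transpose {k : ℕ} (hk : 2 ≤ k) :
    cosineTransform k * (cosineTransform k)ᵀ = 1 := by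
  have hk' : (0 : ℝ) < k := by positivity
  have hsum : ∀ m : ℤ, -(2 * k : ℤ) < m → m < 2 * k →
      ∑ i : Fin k, cos (π * m * (2 * i + 1) / (2 * k)) = if m = 0 then (k : ℝ) else 0 := by
    intro m h1 h2
    rw [Fin.sum_univ_eq_sum_range (fun i => cos (π * m * (2 * (i : ℝ) + 1) / (2 * k)))]
    split_ifs with h
    · simp [h]
    · exact sum_cos_odd_multiples (by omega) m h h1 h2
  ext j l
  have hj := j.isLt
  have hl := l.isLt
  have hprod : (cosineTransform k * (cosineTransform k)ᵀ) j l
      = √((if j.val = 0 then 1 else 2) / k) * √((if l.val = 0 then 1 else 2) / k) / 2 *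
        (∑ i : Fin k, cos (π * ((j + l : ℤ) : ℝ) * (2 * i + 1) / (2 * k))
          + ∑ i : Fin k, cos (π * ((j - l : ℤ) : ℝ) * (2 * i + 1) / (2 * k))) := by
    rw [mul_apply, ← Finset.sum_add_distrib, Finset.mul_sum]
    refine Finset.sum_congr rfl fun i _ => ?_
    simp only [cosineTransform, of_apply, transpose_apply]
    have e1 : π * ((j + l : ℤ) : ℝ) * (2 * i + 1) / (2 * k)
        = π * j * (2 * i + 1) / (2 * k) + π * l * (2 * i + 1) / (2 * k) := by
      push_cast; ring
    have e2 : π * ((j - l : ℤ) : ℝ) * (2 * i + 1) / (2 * k)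
        = π * j * (2 * i + 1) / (2 * k) - π * l * (2 * i + 1) / (2 * k) := by
      push_cast; ring
    rw [e1, e2, cos_add, cos_sub]
    ring
  rw [hprod, hsum _ (by omega) (by omega), hsum _ (by omega) (by omega), one_apply]
  by_cases h : j = l
  · subst h
    rw [mul_self_sqrt (by split_ifs <;> positivity)]
    by_cases h0 : j.val = 0
    · simp [h0]; field_simp; norm_num
    · simp [h0]; field_simp
  · have : j.val ≠ l.val := fun h' => h (Fin.ext h')
    rw [if_neg (show ¬ ((j : ℤ) + l = 0) by omega), if_neg (show ¬ ((j : ℤ) - l = 0) by omega),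
      if_neg h]
    simp

-- Each row of the transform samples a cosine symmetric about both ends of the path, so it meets the
-- Neumann condition and is an eigenvector.
open Real Matrix in
theorem pathLaplacian_mul_transpose {k : ℕ} (hk : 2 ≤ k) :
    pathLaplacian k * (cosineTransform k)ᵀ = (cosineTransform k)ᵀ *
      diagonal fun j : Fin k => (2 * sin (π * j / (2 * k))) ^ 2 := by
  have hk' : (0 : ℝ) < k := by positivity
  ext i j
  rw [mul_diagonal]
  have := pathLaplacian_mulVec hk (fun i => (cosineTransform k)ᵀ i j)
    (fun n => √((if j.val = 0 then 1 else 2) / k) * cos (π * j * (2 * n - 1) / (2 * k))) ?_ ?_ ?_ i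
  · rw [mul_apply]
    rw [mulVec, dotProduct] at this
    rw [this]
    simp only [cosineTransform, of_apply, transpose_apply]
    set a := π * j * (2 * i + 1) / (2 * k) with ha
    set b := π * j / (2 * k) with hb
    have e0 : π * j * (2 * ((i + 1 : ℕ) : ℝ) - 1) / (2 * k) = a := by
      rw [ha]; push_cast; ring
    have e1 : π * j * (2 * (i : ℝ) - 1) / (2 * k) = a - 2 * b := by
      rw [ha, hb]; ring
    have e2 : π * j * (2 * ((i + 2 : ℕ) : ℝ) - 1) / (2 * k) = a + 2 * b := by
      rw [ha, hb]; push_cast; ring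
    rw [e0, e1, e2, cos_add, cos_sub, cos_two_mul, mul_pow, sin_sq]
    ring
  · intro i
    simp only [cosineTransform, of_apply, transpose_apply]
    congr 3
    push_cast; ring
  · congr 1
    rw [← cos_neg]
    congr 1
    push_cast; ring
  · congr 1
    have e1 : π * j * (2 * ((k + 1 : ℕ) : ℝ) - 1) / (2 * k) = j * π + π * j / (2 * k) := by
      push_cast; field_simp; ring
    have e2 : π * j * (2 * (k : ℝ) - 1) / (2 * k) = j * π - π * j / (2 * k) := by
      field_simp
    rw [e1, e2, cos_add, cos_sub, sin_nat_mul_pi]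
    ring

open Real Matrix in
/-- The Laplacian of a path has a symmetric square root whose first column has no zero entry. -/
theorem exists_sqrt_pathLaplacian {k : ℕ} (hk : 2 ≤ k) :
    ∃ S : Matrix (Fin k) (Fin k) ℝ, S.IsSymm ∧ S * S = pathLaplacian k ∧
      ∀ i, S i ⟨0, by omega⟩ ≠ 0 := by
  set Q := cosineTransform k with hQ
  have hQQ : Q * Qᵀ = 1 := cosineTransform_mul_transpose hk
  have hQQ' : Qᵀ * Q = 1 := mul_eq_one_comm.1 hQQ
  have hk' : (0 : ℝ) < k := by positivity
  refine ⟨Qᵀ * diagonal (fun j : Fin k => 2 * sin (π * j / (2 * k))) * Q, ?_, ?_, fun i => ?_⟩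
  · rw [IsSymm, transpose_mul, transpose_mul, transpose_transpose, diagonal_transpose, mul_assoc]
  · calc _ = Qᵀ * diagonal (fun j : Fin k => 2 * sin (π * j / (2 * k))) * (Q * Qᵀ)
          * diagonal (fun j : Fin k => 2 * sin (π * j / (2 * k))) * Q := by
          simp only [mul_assoc]
      _ = (Qᵀ * diagonal fun j : Fin k => (2 * sin (π * j / (2 * k))) ^ 2) * Q := by
          rw [hQQ, mul_one, mul_assoc Qᵀ, diagonal_mul_diagonal]
          simp only [pow_two]
      _ = pathLaplacian k := by
          rw [← pathLaplacian_mul_transpose hk, mul_assoc, hQQ', mul_one]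
  · have : (Qᵀ * diagonal (fun j : Fin k => 2 * sin (π * j / (2 * k))) * Q) i ⟨0, by omega⟩
        = 2 / k * ∑ j ∈ Finset.range k, sin (π * j / k) * cos (π * j * (2 * i + 1) / (2 * k)) := by
      rw [← Fin.sum_univ_eq_sum_range
        (fun j => sin (π * (j : ℝ) / k) * cos (π * j * (2 * i + 1) / (2 * k))), Finset.mul_sum,
        mul_apply]
      refine Finset.sum_congr rfl fun j _ => ?_
      rw [mul_diagonal]
      simp only [hQ, cosineTransform, transpose_apply, of_apply]
      by_cases h0 : j.val = 0
      · simp [h0]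
      · rw [if_neg h0]
        have hsq : √(2 / (k : ℝ)) * √(2 / k) = 2 / k := mul_self_sqrt (by positivity)
        have e : π * j / k = 2 * (π * j / (2 * k)) := by field_simp
        have e0 : π * j * (2 * ((0 : ℕ) : ℝ) + 1) / (2 * k) = π * j / (2 * k) := by simp
        rw [e0, e, sin_two_mul]
        linear_combination (cos (π * j * (2 * i + 1) / (2 * k)) * 2 * sin (π * j / (2 * k))
          * cos (π * j / (2 * k))) * hsq
    rw [this]
    exact mul_ne_zero (by positivity) (sum_sin_mul_cos_ne_zero hk i)

/-! ### The polynomial carrying all eigenvalues -/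

section Recurrence

open Polynomial

/-- The polynomials `p` with `p (n + 2) = (2 - X) p (n + 1) - p n`, `p 0 = 0`, `p 1 = 1`. -/
noncomputable def recPoly : ℕ → ℝ[X]
  | 0 => 0
  | 1 => 1
  | n + 2 => (C 2 - X) * recPoly (n + 1) - recPoly n

/-- Up to sign, the characteristic polynomial of the tridiagonal `k × k` matrix with diagonal
`2, …, 2, 1 - 1 / k` and off-diagonal entries `-1`. -/
noncomputable def rimPoly (k : ℕ) : ℝ[X] :=
  (C (1 - 1 / (k : ℝ)) - X) * recPoly k - recPoly (k - 1)

theorem natDegree_recPoly_le (n : ℕ) : (recPoly n).natDegree ≤ n - 1 := by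
  have hX : (C (2 : ℝ) - X).natDegree ≤ 1 :=
    (natDegree_sub_le _ _).trans (by simp)
  induction n using Nat.twoStepInduction with
  | zero => simp [recPoly]
  | one => simp [recPoly]
  | more n ih1 ih2 =>
    rw [recPoly]
    refine (natDegree_sub_le _ _).trans (max_le (natDegree_mul_le.trans ?_) ?_) <;> omega

theorem natDegree_rimPoly_le {k : ℕ} (hk : 1 ≤ k) : (rimPoly k).natDegree ≤ k := by
  have hX : (C (1 - 1 / (k : ℝ)) - X).natDegree ≤ 1 :=
    (natDegree_sub_le _ _).trans (by simp only [natDegree_C, natDegree_X]; omega)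
  have h1 := natDegree_recPoly_le k
  have h2 := natDegree_recPoly_le (k - 1)
  exact (natDegree_sub_le _ _).trans (max_le (natDegree_mul_le.trans (by omega)) (by omega))

/-- At -1 the recurrence has coefficient 3, so the values increase and the polynomial is positive
there. -/
theorem rimPoly_ne_zero {k : ℕ} (hk : 2 ≤ k) : rimPoly k ≠ 0 := by
  have hmono : ∀ n, 0 ≤ (recPoly n).eval (-1) ∧
      (recPoly n).eval (-1) + 1 ≤ (recPoly (n + 1)).eval (-1) := by
    intro n
    induction n with
    | zero => simp [recPoly]
    | succ n ih =>
      refine ⟨by linarith, ?_⟩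
      simp only [recPoly, eval_sub, eval_mul, eval_C, eval_X]
      linarith
  intro h0
  have h := congrArg (eval (-1)) h0
  obtain ⟨n, rfl⟩ : ∃ n, k = n + 1 := ⟨k - 1, by omega⟩
  obtain ⟨h1, h2⟩ := hmono n
  simp only [rimPoly, eval_sub, eval_mul, eval_C, eval_X, eval_zero, add_tsub_cancel_right] at h
  have hle : 1 / ((n + 1 : ℕ) : ℝ) ≤ 1 := by
    rw [div_le_one (by positivity)]
    push_cast; linarith [(n.cast_nonneg : (0 : ℝ) ≤ n)]
  nlinarith

/-- The recurrence makes φ a multiple of the values `recPoly` takes at μ; nontriviality makes the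
factor φ 1 nonzero, and the end condition becomes the vanishing of `rimPoly`. -/
theorem eval_rimPoly_eq_zero {k : ℕ} (hk : 1 ≤ k) (μ : ℝ) (φ : ℕ → ℝ) (h0 : φ 0 = 0)
    (hrec : ∀ m, m + 1 < k → φ (m + 2) = (2 - μ) * φ (m + 1) - φ m)
    (hlast : (1 - 1 / (k : ℝ) - μ) * φ k = φ (k - 1)) (hne : ∃ m ≤ k, φ m ≠ 0) :
    (rimPoly k).eval μ = 0 := by
  have hφ : ∀ m, m ≤ k → φ m = φ 1 * (recPoly m).eval μ := by
    intro m
    induction m using Nat.twoStepInduction with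
    | zero => simp [recPoly, h0]
    | one => simp [recPoly]
    | more n ih1 ih2 =>
      intro hm
      rw [hrec n (by omega), ih1 (by omega), ih2 (by omega)]
      simp only [recPoly, eval_sub, eval_mul, eval_C, eval_X]
      ring
  have h1 : φ 1 ≠ 0 := by
    intro h
    obtain ⟨m, hm, hne⟩ := hne
    rw [hφ m hm, h, zero_mul] at hne
    exact hne rfl
  rw [hφ k le_rfl, hφ (k - 1) (by omega)] at hlast
  apply mul_left_cancel₀ h1
  simp only [rimPoly, eval_sub, eval_mul, eval_C, eval_X]
  linear_combination hlast

theorem eval_rimPoly_zero {k : ℕ} (hk : 1 ≤ k) : (rimPoly k).eval 0 = 0 := by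
  refine eval_rimPoly_eq_zero hk 0 (fun m => m) (by simp) (fun m _ => by push_cast; ring) ?_
    ⟨1, hk, by simp⟩
  have : (k : ℝ) ≠ 0 := by positivity
  rw [Nat.cast_sub hk]
  field_simp
  ring

end Recurrence

/-! ### Odd and even eigenvectors -/

section Eigenvectors

open Matrix

/-- The difference between a path block and its mean with the twisted path block. -/
noncomputable def endWeights (k : ℕ) (i : Fin k) : ℝ :=
  if i.val = 0 then -(1 / 2) else if i.val + 1 = k then 1 / (2 * k) else 0

theorem exists_path_extension {k : ℕ} (hk : 2 ≤ k) (v : Fin k → ℝ) :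
    ∃ G : ℕ → ℝ, (∀ i : Fin k, v i = G (i + 1)) ∧ G 0 = G 1 ∧ G (k + 1) = G k := by
  refine ⟨fun n => v ⟨min (n - 1) (k - 1), by omega⟩, fun i => ?_, rfl, ?_⟩
  · exact congrArg v (Fin.ext (by have := i.isLt; simp only; omega))
  · exact congrArg v (Fin.ext (by simp only; omega))

theorem eval_rimPoly_of_odd {k : ℕ} (hk : 2 ≤ k) (μ : ℝ) (f : Fin k → ℝ) (hf : f ≠ 0)
    (h : ∀ i, (pathLaplacian k *ᵥ f) i - 2 * endWeights k i * f i = μ * f i) :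
    (rimPoly k).eval μ = 0 := by
  obtain ⟨G, hG, h0, h1⟩ := exists_path_extension hk f
  have hL := pathLaplacian_mulVec hk f G hG h0 h1
  have hk' : (k : ℝ) ≠ 0 := by positivity
  refine eval_rimPoly_eq_zero (by omega) μ (fun n => if n = 0 then 0 else G n) (by simp) ?_ ?_ ?_
  · intro m hm
    have hm' := h ⟨m, by omega⟩
    rw [hL, hG] at hm'
    simp only [endWeights] at hm'
    rw [if_neg (by omega), if_neg (by omega)]
    by_cases hz : m = 0
    · subst hz
      simp only [if_true, zero_add] at hm' ⊢
      rw [h0] at hm'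
      linarith
    · rw [if_neg hz]
      rw [if_neg hz, if_neg (by omega)] at hm'
      linarith
  · have hm' := h ⟨k - 1, by omega⟩
    rw [hL, hG] at hm'
    simp only [endWeights] at hm'
    rw [if_neg (by omega), if_pos (by omega), show k - 1 + 1 = k by omega,
      show k - 1 + 2 = k + 1 by omega, h1] at hm'
    rw [if_neg (by omega), if_neg (by omega)]
    field_simp at hm' ⊢
    linarith
  · obtain ⟨i, hi⟩ := Function.ne_iff.1 hf
    refine ⟨i + 1, i.isLt, ?_⟩
    rw [if_neg (by omega), ← hG]
    exact hi

theorem eval_rimPoly_of_even {k : ℕ} (hk : 2 ≤ k) {S : Matrix (Fin k) (Fin k) ℝ} (hS : S.IsSymm)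
    (hSS : S * S = pathLaplacian k) (μ h : ℝ) (v : Fin k → ℝ) (hne : h ≠ 0 ∨ v ≠ 0)
    (hhub : (1 - 1 / (k : ℝ)) * h + ∑ i, S i ⟨0, by omega⟩ * v i = μ * h)
    (hrim : ∀ i, S i ⟨0, by omega⟩ * h + (pathLaplacian k *ᵥ v) i = μ * v i) :
    (rimPoly k).eval μ = 0 := by
  by_cases hμ : μ = 0
  · rw [hμ]; exact eval_rimPoly_zero (by omega)
  set z : Fin k := ⟨0, by omega⟩ with hz
  set w : Fin k → ℝ := S *ᵥ v with hw
  have hw0 : ∑ i, S i z * v i = w z := by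
    rw [hw, mulVec, dotProduct]
    exact Finset.sum_congr rfl fun i _ => by rw [hS.apply]
  rw [hw0] at hhub
  -- Applying S to the rim equation gives P q = μ w, which no longer involves S.
  set q : Fin k → ℝ := w + Pi.single z h with hq
  have hPq : pathLaplacian k *ᵥ q = μ • w := by
    have hv : S *ᵥ Pi.single z h + pathLaplacian k *ᵥ v = μ • v := by
      ext i
      have := hrim i
      simp only [Pi.add_apply, mulVec_single, Pi.smul_apply, smul_eq_mul, col_apply,
        MulOpposite.smul_eq_mul_unop, MulOpposite.unop_op]
      exact this
    calc pathLaplacian k *ᵥ q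
        = S *ᵥ (S *ᵥ Pi.single z h + pathLaplacian k *ᵥ v) := by
          rw [hq, hw, mulVec_add, mulVec_add, ← hSS]
          simp only [mulVec_mulVec, mul_assoc]
          rw [add_comm]
      _ = μ • w := by rw [hv, mulVec_smul]
  obtain ⟨G, hG, h0, h1⟩ := exists_path_extension hk q
  have hL := pathLaplacian_mulVec hk q G hG h0 h1
  obtain ⟨W, hW⟩ : ∃ W : ℕ → ℝ, ∀ i : Fin k, w i = W i :=
    ⟨fun n => if hn : n < k then w ⟨n, hn⟩ else 0, fun i => by simp⟩
  have hqW : ∀ n, n < k → G (n + 1) = W n + if n = 0 then h else 0 := by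
    intro n hn
    have e := hG ⟨n, hn⟩
    rw [← e, hq, Pi.add_apply, hW, Pi.single_apply]
    simp [hz, Fin.ext_iff]
  set Y : ℕ → ℝ := fun n => ∑ i ∈ Finset.range n, W i with hY
  have hYs : ∀ n, Y (n + 1) = Y n + W n := fun n => Finset.sum_range_succ _ _
  have hY0 : Y 0 = 0 := Finset.sum_range_zero _
  have hsum : ∀ n, n ≤ k → μ * Y n = G n - G (n + 1) := by
    intro n
    induction n with
    | zero => intro _; rw [hY0, h0]; ring
    | succ n ih =>
      intro hn
      have e := congrFun hPq ⟨n, by omega⟩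
      rw [hL, Pi.smul_apply, smul_eq_mul, hW] at e
      simp only at e
      rw [hYs, mul_add, ih (by omega), ← e]
      ring
  have hYk : Y k = 0 := by
    have := hsum k le_rfl
    rw [h1, sub_self] at this
    exact (mul_eq_zero.1 this).resolve_left hμ
  -- With φ 0 = -h, the entries of q are exactly the successive differences of φ; the hub value thus
  -- becomes the end of one recurrence.
  set φ : ℕ → ℝ := fun n => if n = 0 then -h else Y n with hφ
  have hφs : ∀ n, 1 ≤ n → n < k → μ * φ n = 2 * φ n - φ (n - 1) - φ (n + 1) := by
    intro n hn1 hn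
    obtain ⟨n, rfl⟩ : ∃ m, n = m + 1 := ⟨n - 1, by omega⟩
    have e1 := hqW n (by omega)
    have e2 := hqW (n + 1) (by omega)
    have e3 := hsum (n + 1) (by omega)
    have e4 := hYs n
    have e5 := hYs (n + 1)
    simp only [hφ, add_tsub_cancel_right]
    rw [if_neg (show ¬ n + 1 = 0 by omega), if_neg (show ¬ n + 1 + 1 = 0 by omega)]
    rw [if_neg (show ¬ n + 1 = 0 by omega)] at e2
    by_cases hn0 : n = 0
    · subst hn0
      simp only [if_true] at e1 ⊢
      linarith
    · rw [if_neg hn0] at e1 ⊢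
      linarith
  -- Reversed, because φ vanishes at k while the hub equation is the end condition at 0.
  refine eval_rimPoly_eq_zero (by omega) μ (fun n => φ (k - n)) ?_ ?_ ?_ ?_
  · simp only [hφ, tsub_zero]
    rw [if_neg (by omega), hYk]
  · intro m hm
    have e := hφs (k - (m + 1)) (by omega) (by omega)
    rw [show k - (m + 1) - 1 = k - (m + 2) by omega, show k - (m + 1) + 1 = k - m by omega] at e
    linarith
  · have e1 : φ (k - k) = -h := by simp [hφ]
    have e2 : φ (k - (k - 1)) = W 0 := by
      rw [show k - (k - 1) = 0 + 1 by omega]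
      simp [hφ, hYs, hY0]
    rw [e1, e2]
    rw [hW] at hhub
    linarith
  · by_contra hcon
    push Not at hcon
    have hall : ∀ n, n ≤ k → φ n = 0 := by
      intro n hn
      have := hcon (k - n) (by omega)
      rwa [show k - (k - n) = n by omega] at this
    have hh : h = 0 := by simpa [hφ] using hall 0 (by omega)
    have hYz : ∀ n, n ≤ k → Y n = 0 := by
      intro n hn
      rcases Nat.eq_zero_or_pos n with h' | h'
      · rw [h', hY0]
      · have := hall n hn
        simp only [hφ] at this
        rwa [if_neg (by omega)] at this
    have hwz : w = 0 := by
      ext i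
      have := hYs i
      rw [hYz _ i.isLt, hYz _ i.isLt.le] at this
      rw [hW, Pi.zero_apply]
      linarith
    refine hne.elim (fun h' => h' hh) fun h' => h' ?_
    ext i
    have e := hrim i
    rw [← hSS, ← mulVec_mulVec, ← hw, hwz, hh, mulVec_zero] at e
    simpa [hμ] using e

end Eigenvectors

/-! ### The extremal wheel -/

section Construction

open Matrix

/-- The rim of the wheel, split into two paths running in opposite directions. -/
def rimEquiv (k : ℕ) : Fin k ⊕ Fin k ≃ Fin (2 * k) :=
  ((Equiv.sumCongr (Equiv.refl _) Fin.revPerm).trans finSumFinEquiv).trans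
    (finCongr (two_mul k).symm)

theorem rimEquiv_inl (k : ℕ) (a : Fin k) : (rimEquiv k (Sum.inl a)).val = a := by
  simp [rimEquiv]

theorem rimEquiv_inr (k : ℕ) (a : Fin k) : (rimEquiv k (Sum.inr a)).val = 2 * k - 1 - a := by
  have := a.isLt
  simp [rimEquiv, Fin.val_rev]
  omega

/-- A weighted wheel, symmetric under the reflection exchanging the two halves of the rim. -/
noncomputable def foldedWheel {k : ℕ} (b : Fin k → ℝ) :
    Matrix (Fin 1 ⊕ (Fin k ⊕ Fin k)) (Fin 1 ⊕ (Fin k ⊕ Fin k)) ℝ :=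
  fromBlocks (of fun _ _ => 1 - 1 / (k : ℝ)) (of fun _ j => Sum.elim b b j)
    (of fun i _ => Sum.elim b b i)
    (fromBlocks (pathLaplacian k - diagonal (endWeights k)) (diagonal (endWeights k))
      (diagonal (endWeights k)) (pathLaplacian k - diagonal (endWeights k)))

theorem foldedWheel_isSymm {k : ℕ} (b : Fin k → ℝ) : (foldedWheel b).IsSymm := by
  have hP := pathLaplacian_isSymm k
  have hD : (diagonal (endWeights k)).IsSymm := isSymm_diagonal _
  refine IsSymm.fromBlocks rfl rfl (IsSymm.fromBlocks (hP.sub hD) hD.eq (hP.sub hD))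

theorem pathLaplacian_apply_ne_zero_iff {k : ℕ} {i j : Fin k} (hij : i ≠ j) :
    pathLaplacian k i j ≠ 0 ↔ i.val + 1 = j.val ∨ j.val + 1 = i.val := by
  simp [pathLaplacian, hij, or_iff_not_imp_left]

theorem endWeights_ne_zero_iff {k : ℕ} (i : Fin k) :
    endWeights k i ≠ 0 ↔ i.val = 0 ∨ i.val + 1 = k := by
  have : (k : ℝ) ≠ 0 := by have := i.isLt; exact_mod_cast (by omega : k ≠ 0)
  unfold endWeights
  split_ifs with h1 h2 <;> simp_all

theorem foldedWheel_pattern {k : ℕ} (hk : 2 ≤ k) (b : Fin k → ℝ) (hb : ∀ i, b i ≠ 0)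
    (i j : Fin 1 ⊕ (Fin k ⊕ Fin k)) (hij : i ≠ j) :
    foldedWheel b i j ≠ 0 ↔
      (join (⊤ : SimpleGraph (Fin 1)) (SimpleGraph.cycleGraph (2 * k))).Adj
        (Equiv.sumCongr (Equiv.refl _) (rimEquiv k) i)
        (Equiv.sumCongr (Equiv.refl _) (rimEquiv k) j) := by
  rcases i with i | (i | i) <;> rcases j with j | (j | j)
  · exact absurd (congrArg Sum.inl (Subsingleton.elim i j)) hij
  · simp [foldedWheel, join, hb]
  · simp [foldedWheel, join, hb]
  · simp [foldedWheel, join, hb]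
  · have h : i ≠ j := by rintro rfl; exact hij rfl
    have e : foldedWheel b (Sum.inr (Sum.inl i)) (Sum.inr (Sum.inl j)) = pathLaplacian k i j := by
      simp [foldedWheel, h]
    rw [e, pathLaplacian_apply_ne_zero_iff h]
    simp only [join, Equiv.sumCongr_apply, Sum.map_inr, SimpleGraph.sup_adj,
      SimpleGraph.sum_adj, cycleGraph_adj_iff_val (show 3 ≤ 2 * k by omega), rimEquiv_inl,
      completeBipartiteGraph_adj, Sum.isLeft_inr, Sum.isRight_inr]
    have := i.isLt
    have := j.isLt
    simp
    omega
  · have e : foldedWheel b (Sum.inr (Sum.inl i)) (Sum.inr (Sum.inr j)) ≠ 0 ↔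
        i = j ∧ endWeights k i ≠ 0 := by
      simp [foldedWheel, diagonal_apply]
    rw [e, endWeights_ne_zero_iff, Fin.ext_iff]
    simp only [join, Equiv.sumCongr_apply, Sum.map_inr, SimpleGraph.sup_adj,
      SimpleGraph.sum_adj, cycleGraph_adj_iff_val (show 3 ≤ 2 * k by omega), rimEquiv_inl,
      rimEquiv_inr, completeBipartiteGraph_adj, Sum.isLeft_inr, Sum.isRight_inr]
    have := i.isLt
    have := j.isLt
    simp
    omega
  · simp [foldedWheel, join, hb]
  · have e : foldedWheel b (Sum.inr (Sum.inr i)) (Sum.inr (Sum.inl j)) ≠ 0 ↔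
        i = j ∧ endWeights k i ≠ 0 := by
      simp [foldedWheel, diagonal_apply]
    rw [e, endWeights_ne_zero_iff, Fin.ext_iff]
    simp only [join, Equiv.sumCongr_apply, Sum.map_inr, SimpleGraph.sup_adj,
      SimpleGraph.sum_adj, cycleGraph_adj_iff_val (show 3 ≤ 2 * k by omega), rimEquiv_inl,
      rimEquiv_inr, completeBipartiteGraph_adj, Sum.isLeft_inr, Sum.isRight_inr]
    have := i.isLt
    have := j.isLt
    simp
    omega
  · have h : i ≠ j := by rintro rfl; exact hij rfl
    have e : foldedWheel b (Sum.inr (Sum.inr i)) (Sum.inr (Sum.inr j)) = pathLaplacian k i j := by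
      simp [foldedWheel, h]
    rw [e, pathLaplacian_apply_ne_zero_iff h]
    simp only [join, Equiv.sumCongr_apply, Sum.map_inr, SimpleGraph.sup_adj,
      SimpleGraph.sum_adj, cycleGraph_adj_iff_val (show 3 ≤ 2 * k by omega),
      rimEquiv_inr, completeBipartiteGraph_adj, Sum.isLeft_inr, Sum.isRight_inr]
    have := i.isLt
    have := j.isLt
    simp
    omega

theorem exists_eigenvector_of_mem_spectrum {m : Type*} [Fintype m] [DecidableEq m]
    {A : Matrix m m ℝ} {μ : ℝ} (h : μ ∈ spectrum ℝ A) : ∃ x ≠ 0, A *ᵥ x = μ • x := by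
  rw [spectrum.mem_iff, isUnit_iff_isUnit_det, isUnit_iff_ne_zero, not_not] at h
  obtain ⟨x, hx, h⟩ := exists_mulVec_eq_zero_iff.2 h
  refine ⟨x, hx, ?_⟩
  rw [sub_mulVec, sub_eq_zero, Algebra.algebraMap_eq_smul_one, smul_mulVec, one_mulVec] at h
  exact h.symm

/-- Reflection splits an eigenvector: if y - z ≠ 0 it solves the odd equation; otherwise y + z, with
hub value √2 c to match the border S e₀/√2, solves the even one. -/
theorem eval_rimPoly_of_mem_spectrum {k : ℕ} (hk : 2 ≤ k) {S : Matrix (Fin k) (Fin k) ℝ}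
    (hS : S.IsSymm) (hSS : S * S = pathLaplacian k) {μ : ℝ}
    (hμ : μ ∈ spectrum ℝ (foldedWheel fun i => S i ⟨0, by omega⟩ / √2)) :
    (rimPoly k).eval μ = 0 := by
  obtain ⟨x, hx, h⟩ := exists_eigenvector_of_mem_spectrum hμ
  set y : Fin k → ℝ := fun i => x (Sum.inr (Sum.inl i)) with hy
  set z : Fin k → ℝ := fun i => x (Sum.inr (Sum.inr i)) with hz
  set c : ℝ := x (Sum.inl 0) with hc
  set b : Fin k → ℝ := fun i => S i ⟨0, by omega⟩ / √2 with hb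
  have hxe : x = Sum.elim (fun _ => c) (Sum.elim y z) := by
    ext (i | (i | i))
    · rw [Subsingleton.elim i 0]; rfl
    · rfl
    · rfl
  rw [hxe, foldedWheel, fromBlocks_mulVec] at h
  have hhub := congrFun h (Sum.inl 0)
  have hl := fun i => congrFun h (Sum.inr (Sum.inl i))
  have hr := fun i => congrFun h (Sum.inr (Sum.inr i))
  simp only [Sum.elim_inl, Sum.elim_inr, Pi.add_apply, Pi.smul_apply, smul_eq_mul,
    Sum.elim_comp_inl, Sum.elim_comp_inr, fromBlocks_mulVec, sub_mulVec, Pi.sub_apply,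
    mulVec_diagonal] at hhub hl hr
  simp only [mulVec, dotProduct, of_apply, Fintype.sum_sum_type, Sum.elim_inl, Sum.elim_inr,
    Finset.univ_unique, Finset.sum_singleton] at hhub
  have hbl : ∀ i : Fin k, ((of fun (i : Fin k ⊕ Fin k) (_ : Fin 1) => Sum.elim b b i) *ᵥ
      fun _ => c) (Sum.inl i) = b i * c := by
    intro i; simp [mulVec, dotProduct]
  have hbr : ∀ i : Fin k, ((of fun (i : Fin k ⊕ Fin k) (_ : Fin 1) => Sum.elim b b i) *ᵥ
      fun _ => c) (Sum.inr i) = b i * c := by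
    intro i; simp [mulVec, dotProduct]
  simp only [hbl] at hl
  simp only [hbr] at hr
  by_cases hyz : y - z = 0
  · have hs2 : √2 * √2 = (2 : ℝ) := Real.mul_self_sqrt (by norm_num)
    have hs : √(2 : ℝ) ≠ 0 := by positivity
    have hbS : ∀ i, S i ⟨0, by omega⟩ = √2 * b i := fun i => by rw [hb]; field_simp
    refine eval_rimPoly_of_even hk hS hSS μ (√2 * c) (y + z) ?_ ?_ ?_
    · by_contra hcon
      push Not at hcon
      have hc0 : c = 0 := by simpa [hs] using hcon.1
      have hyz' : y = z := sub_eq_zero.1 hyz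
      have hz0 : z = 0 := by
        have := hcon.2
        rw [hyz'] at this
        ext i
        have := congrFun this i
        simp only [Pi.add_apply, Pi.zero_apply] at this ⊢
        linarith
      apply hx
      rw [hxe, hyz', hz0, hc0]
      ext (i | (i | i)) <;> rfl
    · simp only [hbS, Pi.add_apply]
      have : ∑ i, √2 * b i * (y i + z i) = √2 * (∑ i, b i * y i + ∑ i, b i * z i) := by
        rw [← Finset.sum_add_distrib, Finset.mul_sum]
        exact Finset.sum_congr rfl fun i _ => by ring
      rw [this]
      linear_combination √2 * hhub
    · intro i
      rw [hbS, mulVec_add]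
      simp only [Pi.add_apply]
      linear_combination hl i + hr i + b i * c * hs2
  · refine eval_rimPoly_of_odd hk μ (y - z) hyz fun i => ?_
    rw [mulVec_sub]
    simp only [Pi.sub_apply]
    linear_combination hl i - hr i

theorem exists_numDistinctEigenvalues_le {k : ℕ} (hk : 2 ≤ k) :
    ∃ A ∈ graphMatrices (join (⊤ : SimpleGraph (Fin 1)) (SimpleGraph.cycleGraph (2 * k))),
      numDistinctEigenvalues A ≤ k := by
  obtain ⟨S, hS, hSS, hS0⟩ := exists_sqrt_pathLaplacian hk
  set b : Fin k → ℝ := fun i => S i ⟨0, by omega⟩ / √2 with hb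
  have hb0 : ∀ i, b i ≠ 0 := fun i => div_ne_zero (hS0 i) (by positivity)
  set e : Fin 1 ⊕ (Fin k ⊕ Fin k) ≃ Fin 1 ⊕ Fin (2 * k) :=
    Equiv.sumCongr (Equiv.refl _) (rimEquiv k) with he
  refine ⟨reindexAlgEquiv ℝ ℝ e (foldedWheel b), ⟨?_, fun i j hij => ?_⟩, ?_⟩
  · exact (foldedWheel_isSymm b).submatrix _
  · have := foldedWheel_pattern hk b hb0 (e.symm i) (e.symm j) (e.symm.injective.ne hij)
    rw [← he, e.apply_symm_apply, e.apply_symm_apply] at this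
    exact this
  · rw [numDistinctEigenvalues, AlgEquiv.spectrum_eq]
    have hsub : spectrum ℝ (foldedWheel b) ⊆ ((rimPoly k).roots.toFinset : Set ℝ) := by
      intro μ hμ
      rw [Finset.mem_coe, Multiset.mem_toFinset, Polynomial.mem_roots (rimPoly_ne_zero hk)]
      exact eval_rimPoly_of_mem_spectrum hk hS hSS hμ
    calc (spectrum ℝ (foldedWheel b)).ncard
        ≤ ((rimPoly k).roots.toFinset : Set ℝ).ncard :=
          Set.ncard_le_ncard hsub (Finset.finite_toSet _)
      _ = (rimPoly k).roots.toFinset.card := Set.ncard_coe_finset _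
      _ ≤ (rimPoly k).roots.card := Multiset.toFinset_card_le _
      _ ≤ (rimPoly k).natDegree := Polynomial.card_roots' _
      _ ≤ k := natDegree_rimPoly_le (by omega)

end Construction

end CycleJoin

theorem mainTheorem7 (k : ℕ) (hk : 2 ≤ k) :
    CycleJoin.minDistinctEigenvalues
      (CycleJoin.join (⊤ : SimpleGraph (Fin 1)) (SimpleGraph.cycleGraph (2 * k))) = k := by
  apply le_antisymm
  · obtain ⟨A, hA, hle⟩ := CycleJoin.exists_numDistinctEigenvalues_le hk
    exact (Nat.sInf_le (Set.mem_image_of_mem _ hA)).trans hle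
  · refine le_csInf ((CycleJoin.graphMatrices_nonempty _).image _) ?_
    rintro _ ⟨A, hA, rfl⟩
    exact CycleJoin.le_numDistinctEigenvalues_wheel k hk A hA
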